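/- Let $\Gamma$ be a finite simplicial graph (undirected, no loops or multiple edges) with vertex set $V$. A clique is a set $\sigma\subseteq V$ of pairwise adjacent vertices (a $k$-clique if $|\sigma|=k$), and its link is $\mathrm{Lk}(\sigma)=\{v\in V\setminus\sigma : \sigma\cup\{v\}\text{ is a clique}\}$. Suppose that $\Gamma$ is link-regular, i.e. $|\mathrm{Lk}(\sigma)|=|\mathrm{Lk}(\tau)|$ whenever $\sigma,\tau$ are cliques with $|\sigma|=|\tau|$, and that $\Gamma$ contains no $5$-clique. Let $\ell_0=|V|$ and, for $1\le k\le 3$, let $\ell_k=|\mathrm{Lk}(\sigma)|$ for any $k$-clique $\sigma$ (if $\Gamma$ has no $k$-clique, $\ell_k$ may be any natural number). Let $$\mathrm{RACG}(\Gamma)=\langle V \mid v^2=1\ (v\in V),\ uv=vu\ (\{u,v\}\text{ an edge of }\Gamma)\rangle,$$ let $S$ be its standard generating set (the vertices and their inverses, as elements of the group), call a word over $S$ geodesic if no shorter word over $S$ represents the same element, and let $\mathcal G(z)=\sum_{n\ge 0} c_n z^n$, where $c_n$ is the number of geodesic words of length $n$. Then, as formal power series, $\mathcal G(z)=q(z)/p(z)$,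 where $$\begin{aligned} q(z)={}&24z^4+(-\ell_1\ell_2\ell_3+4\ell_1\ell_2+\ell_2\ell_3-12\ell_1-4\ell_2-2\ell_3+50)z^3\\ &+(\ell_1\ell_2+\ell_1\ell_3+\ell_2\ell_3-7\ell_1-5\ell_2-3\ell_3+35)z^2+(-\ell_1-\ell_2-\ell_3+10)z+1,\\ p(z)={}&(\ell_0\ell_1\ell_2\ell_3-4\ell_0\ell_1\ell_2+12\ell_0\ell_1-24\ell_0+24)z^4\\ &+(-\ell_0\ell_1\ell_2-\ell_0\ell_1\ell_3-\ell_0\ell_2\ell_3-\ell_1\ell_2\ell_3+7\ell_0\ell_1+4\ell_0\ell_2+4\ell_1\ell_2+2\ell_0\ell_3\\ &\qquad+\ell_2\ell_3-26\ell_0-12\ell_1-4\ell_2-2\ell_3+50)z^3\\ &+(\ell_0\ell_1+\ell_0\ell_2+\ell_1\ell_2+\ell_0\ell_3+\ell_1\ell_3+\ell_2\ell_3-9\ell_0-7\ell_1-5\ell_2-3\ell_3+35)z^2\\ &+(-\ell_0-\ell_1-\ell_2-\ell_3+10)z+1. \end{aligned}$$ -/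

import Mathlib

open Polynomial

section GeodesicGrowth

/-- The growth series of a language over a finite alphabet: the `n`-th coefficient is the number
of words of length `n` in the language. -/
noncomputable def growthSeries {A : Type*} (L : Language A) : PowerSeries ℚ :=
  PowerSeries.mk fun n => (({x : List A | x ∈ L ∧ x.length = n}.ncard : ℕ) : ℚ)

/-- The evaluation map sending a word over `S ⊆ G` to its product in `G`. -/
def evalWord {G : Type*} [Group G] (S : Set G) (x : List S) : G :=
  (x.map (fun s : S => (s : G))).prod

/-- A word over `S` is a geodesic if no shorter word over `S` evaluates to the same element;
the geodesic language is the set of all geodesics. -/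
def geodesicLanguage {G : Type*} [Group G] (S : Set G) : Language S :=
  {x : List S | ∀ y : List S, evalWord S y = evalWord S x → x.length ≤ y.length}

/-- The geodesic growth series of a group with respect to a symmetric generating set `S`. -/
noncomputable def geodesicGrowthSeries {G : Type*} [Group G] (S : Set G) : PowerSeries ℚ :=
  growthSeries (geodesicLanguage S)

end GeodesicGrowth

section GraphProducts

/-- The relators of the numbered graph product: `v ^ N v` for every vertex `v`, and the commutator
of `u` and `v` for every edge `{u, v}`. -/
def ngpRelators {V : Type*} (Γ : SimpleGraph V) (N : V → ℕ+) : Set (FreeGroup V) :=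
  {r | ∃ v : V, r = FreeGroup.of v ^ (N v : ℕ)} ∪
    {r | ∃ u v : V, Γ.Adj u v ∧ 
      r = FreeGroup.of u * FreeGroup.of v * (FreeGroup.of u)⁻¹ * (FreeGroup.of v)⁻¹}

/-- The numbered graph product of the cyclic groups of orders `N v` over the graph `Γ`. -/
abbrev NGP {V : Type*} (Γ : SimpleGraph V) (N : V → ℕ+) : Type _ :=
  PresentedGroup (ngpRelators Γ N)

/-- The standard generating set of a numbered graph product, as a subset of the group: the
vertices together with their inverses. -/
def ngpGenerators {V : Type*} (Γ : SimpleGraph V) (N : V → ℕ+) : Set (NGP Γ N) :=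
  {g | ∃ v : V, g = PresentedGroup.of v ∨ g = (PresentedGroup.of v)⁻¹}

/-- The right-angled Coxeter group of `Γ`: all vertex numbers are `2`. -/
abbrev RACG {V : Type*} (Γ : SimpleGraph V) : Type _ :=
  NGP Γ (fun _ => 2)

/-- The standard generating set of the right-angled Coxeter group of `Γ`. -/
abbrev racgGenerators {V : Type*} (Γ : SimpleGraph V) : Set (RACG Γ) :=
  ngpGenerators Γ (fun _ => 2)

end GraphProducts

section Links

/-- The link of a clique `σ`: the vertices outside `σ` that form a clique together with `σ`. -/
def cliqueLink {V : Type*} (Γ : SimpleGraph V) (σ : Finset V) : Set V :=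
  {v | v ∉ σ ∧ Γ.IsClique (insert v (σ : Set V))}

/-- A (finite) graph is link-regular if cliques of the same size have links of the same size. -/
def IsLinkRegular {V : Type*} (Γ : SimpleGraph V) : Prop :=
  ∀ σ τ : Finset V, Γ.IsClique (σ : Set V) → Γ.IsClique (τ : Set V) → σ.card = τ.card →
    (cliqueLink Γ σ).encard = (cliqueLink Γ τ).encard

end Links

section Polynomials

/-- The numerator `q(z)`. -/
noncomputable def numeratorPoly (l₁ l₂ l₃ : ℚ) : ℚ[X] :=
  C 24 * X ^ 4
    + C (-l₁ * l₂ * l₃ + 4 * l₁ * l₂ + l₂ * l₃ - 12 * l₁ - 4 * l₂ - 2 * l₃ + 50) * X ^ 3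
    + C (l₁ * l₂ + l₁ * l₃ + l₂ * l₃ - 7 * l₁ - 5 * l₂ - 3 * l₃ + 35) * X ^ 2
    + C (-l₁ - l₂ - l₃ + 10) * X
    + 1

/-- The denominator `p(z)`. -/
noncomputable def denominatorPoly (l₀ l₁ l₂ l₃ : ℚ) : ℚ[X] :=
  C (l₀ * l₁ * l₂ * l₃ - 4 * l₀ * l₁ * l₂ + 12 * l₀ * l₁ - 24 * l₀ + 24) * X ^ 4
    + C (-l₀ * l₁ * l₂ - l₀ * l₁ * l₃ - l₀ * l₂ * l₃ - l₁ * l₂ * l₃ + 7 * l₀ * l₁ + 4 * l₀ * l₂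
        + 4 * l₁ * l₂ + 2 * l₀ * l₃ + l₂ * l₃ - 26 * l₀ - 12 * l₁ - 4 * l₂ - 2 * l₃ + 50) * X ^ 3
    + C (l₀ * l₁ + l₀ * l₂ + l₁ * l₂ + l₀ * l₃ + l₁ * l₃ + l₂ * l₃
        - 9 * l₀ - 7 * l₁ - 5 * l₂ - 3 * l₃ + 35) * X ^ 2
    + C (-l₀ - l₁ - l₂ - l₃ + 10) * X
    + 1

/-- The denominator has constant term `1`, so it is invertible as a power series. -/
theorem denominatorPoly_coeff_zero (l₀ l₁ l₂ l₃ : ℚ) :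
    (denominatorPoly l₀ l₁ l₂ l₃).coeff 0 = 1 := by
  simp [denominatorPoly, Polynomial.coeff_zero_eq_eval_zero]

end Polynomials

/-! Geodesics are built from right to left while tracking the left descent set D(w). A letter v may
be prepended to w exactly when v ∉ D(w), and then D(vw) consists of v and the members of D(w)
adjacent to v. That this local rule detects geodesics rests on `leftDescents_eq_of_racgProd_eq`:
D(w) depends only on the group element, since it is the sign pattern of a vector under the
contragredient representation (`dualRep_sign`).

Descent sets are cliques, so constant link sizes suffice for counting. Let M_i(n) be the sum of
C(|D(w)|, i) over reduced words w of length n. Double counting (`sum_choose_card_neighbors`) and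
Pascal's rule give linear recurrences expressing M_i(n+1) through M_{i-1}(n), M_i(n), M_{i+1}(n).
Without 5-cliques they close up at i = 4. Solving the resulting linear system for the generating
function of M_0 gives q/p. -/

/-! ### Words in the vertices and the defining relations. -/

section CoxeterWords

variable {V : Type*} (Γ : SimpleGraph V)

/-- The element of the right-angled Coxeter group represented by a word in the vertices. -/
def racgProd (w : List V) : RACG Γ :=
  (w.map (PresentedGroup.of (rels := ngpRelators Γ fun _ => 2))).prod

theorem racgProd_cons (v : V) (w : List V) :
    racgProd Γ (v :: w) = PresentedGroup.of v * racgProd Γ w := by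
  simp [racgProd]

theorem racg_of_mul_self (v : V) :
    (PresentedGroup.of v : RACG Γ) * PresentedGroup.of v = 1 := by
  have h : PresentedGroup.mk (ngpRelators Γ fun _ => 2) (FreeGroup.of v ^ ((2 : ℕ+) : ℕ)) = 1 :=
    PresentedGroup.one_of_mem (Or.inl ⟨v, rfl⟩)
  rw [map_pow, PNat.val_ofNat, pow_two] at h
  exact h

theorem racg_of_comm {u v : V} (h : Γ.Adj u v) :
    (PresentedGroup.of u : RACG Γ) * PresentedGroup.of v =
      PresentedGroup.of v * PresentedGroup.of u := by
  have h : PresentedGroup.mk (ngpRelators Γ fun _ => 2)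
      (FreeGroup.of u * FreeGroup.of v * (FreeGroup.of u)⁻¹ * (FreeGroup.of v)⁻¹) = 1 :=
    PresentedGroup.one_of_mem (Or.inr ⟨u, v, h, rfl⟩)
  rw [map_mul, map_mul, map_inv, map_inv, map_mul] at h
  exact mul_inv_eq_iff_eq_mul.1 (mul_inv_eq_one.1 h)

/-- A word in the vertices is geodesic if no shorter such word represents the same element. -/
def IsGeodesicWord (w : List V) : Prop :=
  ∀ y : List V, racgProd Γ y = racgProd Γ w → w.length ≤ y.length

theorem exists_isGeodesicWord (w : List V) :
    ∃ y : List V, racgProd Γ y = racgProd Γ w ∧ IsGeodesicWord Γ y := by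
  obtain ⟨y, hy, hmin⟩ := WellFounded.has_min (measure (List.length (α := V))).wf
    {y | racgProd Γ y = racgProd Γ w} ⟨w, rfl⟩
  exact ⟨y, hy, fun x hx => not_lt.1 (hmin x (hx.trans hy))⟩

end CoxeterWords

/-! ### Descent sets and reduced words. -/

section Coxeter

variable {V : Type*} [DecidableEq V] (Γ : SimpleGraph V) [DecidableRel Γ.Adj]

/-- The letters `v` such that prepending `v` to the reduced word `w` gives a word that is not
reduced: the left descent set of the element represented by `w`. -/
def leftDescents : List V → Finset V
  | [] => ∅
  | v :: w => insert v ((leftDescents w).filter (Γ.Adj v))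

/-- A word is reduced if no letter is prepended to a word having that letter as a descent. -/
def IsReducedWord : List V → Prop
  | [] => True
  | v :: w => v ∉ leftDescents Γ w ∧ IsReducedWord w

theorem isClique_leftDescents (w : List V) : Γ.IsClique (leftDescents Γ w : Set V) := by
  induction w with
  | nil => simp [leftDescents]
  | cons v w ih =>
    rw [leftDescents, Finset.coe_insert, SimpleGraph.isClique_insert]
    refine ⟨ih.subset fun x hx => ?_, fun x hx _ => ?_⟩
    · simp only [Finset.coe_filter, Set.mem_ofPred_eq] at hx
      exact hx.1
    · simp only [Finset.coe_filter, Set.mem_ofPred_eq] at hx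
      exact hx.2

/-- If `v` is a descent of `w`, then `v * w` is represented by a word with one letter less. -/
theorem exists_shorter_of_mem_leftDescents {v : V} {w : List V} (hv : v ∈ leftDescents Γ w) :
    ∃ y : List V, y.length + 1 = w.length ∧
      racgProd Γ y = PresentedGroup.of v * racgProd Γ w := by
  induction w with
  | nil => simp [leftDescents] at hv
  | cons u w ih =>
    rw [leftDescents, Finset.mem_insert, Finset.mem_filter] at hv
    rcases hv with rfl | ⟨hv, huv⟩
    · refine ⟨w, rfl, ?_⟩
      rw [racgProd_cons, ← mul_assoc, racg_of_mul_self, one_mul]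
    · obtain ⟨y, hy, hyw⟩ := ih hv
      refine ⟨u :: y, by simp [hy], ?_⟩
      rw [racgProd_cons, hyw, racgProd_cons, ← mul_assoc, ← mul_assoc, racg_of_comm Γ huv]

/-! ### Descents as signs in the contragredient representation. -/

/-- The reflection of the vertex `v` in the contragredient of the geometric representation. -/
def dualReflection (v : V) : Equiv.Perm (V → ℤ) :=
  Function.Involutive.toPerm
    (fun f u => if u = v then -f v else if Γ.Adj v u then f u else f u + 2 * f v)
    (fun f => by
      funext u
      by_cases h : u = v
      · simp [h]
      · by_cases h' : Γ.Adj v u <;> simp [h, h'])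

theorem dualReflection_apply (v : V) (f : V → ℤ) (u : V) :
    dualReflection Γ v f u =
      if u = v then -f v else if Γ.Adj v u then f u else f u + 2 * f v := rfl

theorem dualReflection_mul_self (v : V) : dualReflection Γ v * dualReflection Γ v = 1 := by
  ext1 f
  exact (dualReflection Γ v).left_inv f

theorem dualReflection_comm {u v : V} (h : Γ.Adj u v) :
    dualReflection Γ u * dualReflection Γ v = dualReflection Γ v * dualReflection Γ u := by
  ext f x
  have hne := h.ne
  have h' := h.symm
  simp only [Equiv.Perm.mul_apply, dualReflection_apply]
  by_cases h1 : x = u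
  · subst h1
    simp [hne, h']
  · by_cases h2 : x = v
    · subst h2
      simp [hne.symm, h]
    · by_cases h3 : Γ.Adj u x <;> by_cases h4 : Γ.Adj v x <;>
        simp [h1, h2, h3, h4, h, h', hne, hne.symm]
      ring

/-- The contragredient of the geometric representation of a right-angled Coxeter group. -/
def dualRep : RACG Γ →* Equiv.Perm (V → ℤ) :=
  PresentedGroup.toGroup (f := dualReflection Γ) (by
    rintro r (⟨v, rfl⟩ | ⟨u, v, h, rfl⟩)
    · simpa [pow_two] using dualReflection_mul_self Γ v
    · simp only [map_mul, map_inv, FreeGroup.lift_apply_of]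
      rw [dualReflection_comm Γ h]
      group)

theorem dualRep_of (v : V) : dualRep Γ (PresentedGroup.of v) = dualReflection Γ v :=
  PresentedGroup.toGroup.of _

/-- The image of the constant function `1` under the element represented by a reduced word is
negative exactly on the descents. -/
theorem dualRep_sign {w : List V} (hw : IsReducedWord Γ w) :
    (∀ u ∈ leftDescents Γ w, dualRep Γ (racgProd Γ w) 1 u < 0) ∧
    (∀ u ∉ leftDescents Γ w, 0 < dualRep Γ (racgProd Γ w) 1 u) ∧
    ∀ u ∈ leftDescents Γ w, ∀ x ∉ leftDescents Γ w, ¬ Γ.Adj u x →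
      0 < dualRep Γ (racgProd Γ w) 1 u + dualRep Γ (racgProd Γ w) 1 x := by
  induction w with
  | nil => simp [leftDescents, racgProd]
  | cons v w ih =>
    obtain ⟨hv, hw⟩ := hw
    obtain ⟨hneg, hpos, hsum⟩ := ih hw
    have hcl := isClique_leftDescents Γ w
    rw [racgProd_cons, map_mul, dualRep_of]
    simp only [Equiv.Perm.mul_apply, leftDescents, Finset.mem_insert, Finset.mem_filter, not_or,
      not_and]
    set f := dualRep Γ (racgProd Γ w) 1
    have hfv := hpos v hv
    refine ⟨?_, ?_, ?_⟩
    · rintro u (rfl | ⟨hu, huv⟩)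
      · simpa [dualReflection_apply] using hfv
      · simpa [dualReflection_apply, huv, huv.ne'] using hneg u hu
    · rintro u ⟨huv, hu⟩
      by_cases hadj : Γ.Adj v u
      · simpa [dualReflection_apply, huv, hadj] using hpos u fun h => hu h hadj
      -- The new value is f u + 2 f v. An old descent u has f u < 0, so positivity needs the third
      -- clause, f u + f v > 0; this is why that clause is carried through the induction.
      · simp only [dualReflection_apply, huv, hadj, if_false]
        by_cases hmem : u ∈ leftDescents Γ w
        · have := hsum u hmem v hv fun h => hadj h.symm
          linarith
        · have := hpos u hmem
          linarith
    · rintro u (rfl | ⟨hu, huv⟩) x ⟨hxv, hx⟩ hux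
      -- The new descent has value minus its old one, so the sum to bound is the old f x + f u.
      · simp only [dualReflection_apply, hxv, hux, if_false, if_true]
        by_cases hmem : x ∈ leftDescents Γ w
        · have := hsum x hmem u hv fun h => hux h.symm
          linarith
        · have := hpos x hmem
          linarith
      · simp only [dualReflection_apply, huv.ne', huv, hxv, if_false, if_true]
        by_cases hadj : Γ.Adj v x
        · simpa [hadj] using hsum u hu x (fun h => hx h hadj) hux
        · simp only [hadj, if_false]
          have hne : u ≠ x := by
            rintro rfl
            exact hadj huv
          -- Two distinct non-adjacent vertices cannot both be descents, because descents form a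
          -- clique.
          have hmem : x ∉ leftDescents Γ w := fun h => hux (hcl hu h hne)
          have := hsum u hu x hmem hux
          linarith

/-- The sign pattern in `dualRep_sign` is a function of the group element alone. This plays the role
of the exchange condition. -/
theorem leftDescents_eq_of_racgProd_eq {w y : List V} (hw : IsReducedWord Γ w)
    (hy : IsReducedWord Γ y) (h : racgProd Γ w = racgProd Γ y) :
    leftDescents Γ w = leftDescents Γ y := by
  obtain ⟨hneg, hpos, -⟩ := dualRep_sign Γ hw
  obtain ⟨hneg', hpos', -⟩ := dualRep_sign Γ hy
  rw [h] at hneg hpos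
  ext u
  refine ⟨fun hu => ?_, fun hu => ?_⟩
  · by_contra hu'
    exact lt_asymm (hneg u hu) (hpos' u hu')
  · by_contra hu'
    exact lt_asymm (hneg' u hu) (hpos u hu')

theorem IsGeodesicWord.isReducedWord {w : List V} (hw : IsGeodesicWord Γ w) :
    IsReducedWord Γ w := by
  induction w with
  | nil => trivial
  | cons v w ih =>
    refine ⟨fun hv => ?_, ih fun y hy => ?_⟩
    · obtain ⟨y, hlen, hy⟩ := exists_shorter_of_mem_leftDescents Γ hv
      have := hw y (by rw [hy, racgProd_cons])
      simp only [List.length_cons] at this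
      omega
    · simpa using hw (v :: y) (by rw [racgProd_cons, racgProd_cons, hy])

/-- Replace a competitor x of v :: w by a geodesic y for the same element. Both words are reduced,
so v is also a descent of y; cancelling it leaves a word for w one letter shorter than y, to which
induction applies. -/
theorem IsReducedWord.isGeodesicWord {w : List V} (hw : IsReducedWord Γ w) :
    IsGeodesicWord Γ w := by
  induction w with
  | nil => exact fun y _ => Nat.zero_le _
  | cons v w ih =>
    intro x hx
    obtain ⟨y, hyx, hy⟩ := exists_isGeodesicWord Γ x
    have hv : v ∈ leftDescents Γ y := by
      rw [← leftDescents_eq_of_racgProd_eq Γ hw (hy.isReducedWord Γ) (hyx.trans hx).symm]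
      exact Finset.mem_insert_self _ _
    obtain ⟨t, hlen, ht⟩ := exists_shorter_of_mem_leftDescents Γ hv
    have h1 : w.length ≤ t.length := by
      refine ih hw.2 t ?_
      rw [ht, hyx, hx, racgProd_cons, ← mul_assoc, racg_of_mul_self, one_mul]
    have h2 := hy x hyx.symm
    simp only [List.length_cons]
    omega

theorem isReducedWord_iff_isGeodesicWord (w : List V) :
    IsReducedWord Γ w ↔ IsGeodesicWord Γ w :=
  ⟨fun h => h.isGeodesicWord Γ, fun h => h.isReducedWord Γ⟩

/-- A one-letter word has that letter as its only descent. Hence the alphabet of generators is a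
faithful copy of V, each generator being its own inverse. -/
theorem racg_of_injective :
    Function.Injective (PresentedGroup.of (rels := ngpRelators Γ fun _ => 2)) := by
  intro u v h
  have h1 := leftDescents_eq_of_racgProd_eq Γ (w := [u]) (y := [v])
    ⟨Finset.notMem_empty u, trivial⟩ ⟨Finset.notMem_empty v, trivial⟩ (by simp [racgProd, h])
  simpa [leftDescents] using h1

/-- The vertices, as the standard generators of the right-angled Coxeter group. -/
noncomputable def vertexEquivGenerators : V ≃ racgGenerators Γ :=
  Equiv.ofBijective (fun v => ⟨PresentedGroup.of v, v, Or.inl rfl⟩) (by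
    refine ⟨fun u v h => racg_of_injective Γ (congrArg Subtype.val h), ?_⟩
    rintro ⟨g, v, rfl | rfl⟩
    · exact ⟨v, rfl⟩
    · exact ⟨v, Subtype.ext (eq_inv_of_mul_eq_one_left (racg_of_mul_self Γ v))⟩)

theorem evalWord_map_vertexEquivGenerators (w : List V) :
    evalWord (racgGenerators Γ) (w.map (vertexEquivGenerators Γ)) = racgProd Γ w := by
  rw [evalWord, racgProd, List.map_map]
  rfl

theorem map_mem_geodesicLanguage_iff (w : List V) :
    w.map (vertexEquivGenerators Γ) ∈ geodesicLanguage (racgGenerators Γ) ↔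
      IsReducedWord Γ w := by
  rw [isReducedWord_iff_isGeodesicWord]
  refine ⟨fun h y hy => ?_, fun h y hy => ?_⟩
  · simpa using h (y.map (vertexEquivGenerators Γ))
      (by simpa only [evalWord_map_vertexEquivGenerators] using hy)
  · obtain ⟨y, rfl⟩ := (vertexEquivGenerators Γ).surjective.list_map y
    simpa using h y (by simpa only [evalWord_map_vertexEquivGenerators] using hy)

end Coxeter

/-! ### Counting reduced words by binomial moments of their descent sets. -/

section Counting

variable {V : Type*} [DecidableEq V] (Γ : SimpleGraph V) [DecidableRel Γ.Adj] [Fintype V]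

/-- The finite set of reduced words of a given length. -/
def reducedWords : ℕ → Finset (List V)
  | 0 => {[]}
  | n + 1 =>
    ((reducedWords n ×ˢ Finset.univ).filter fun p => p.2 ∉ leftDescents Γ p.1).image
      fun p => p.2 :: p.1

theorem mem_reducedWords {n : ℕ} {w : List V} :
    w ∈ reducedWords Γ n ↔ IsReducedWord Γ w ∧ w.length = n := by
  induction n generalizing w with
  | zero =>
    rw [reducedWords, Finset.mem_singleton, List.length_eq_zero_iff]
    refine ⟨?_, And.right⟩
    rintro rfl
    exact ⟨trivial, rfl⟩
  | succ n ih =>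
    simp only [reducedWords, Finset.mem_image, Finset.mem_filter, Finset.mem_product,
      Finset.mem_univ, and_true, ih, Prod.exists]
    constructor
    · rintro ⟨w, v, ⟨⟨hw, rfl⟩, hv⟩, rfl⟩
      exact ⟨⟨hv, hw⟩, rfl⟩
    · rintro ⟨hw, hlen⟩
      cases w with
      | nil => simp at hlen
      | cons v w => exact ⟨w, v, ⟨⟨hw.2, by simpa using hlen⟩, hw.1⟩, rfl⟩

theorem sum_reducedWords_succ {M : Type*} [AddCommMonoid M] (F : List V → M) (n : ℕ) :
    ∑ w ∈ reducedWords Γ (n + 1), F w =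
      ∑ w ∈ reducedWords Γ n, ∑ v ∈ (leftDescents Γ w)ᶜ, F (v :: w) := by
  rw [reducedWords, Finset.sum_image (by
    rintro ⟨w, v⟩ - ⟨w', v'⟩ - h
    simp only [List.cons.injEq] at h
    rw [h.1, h.2]), Finset.sum_filter, Finset.sum_product]
  refine Finset.sum_congr rfl fun w _ => ?_
  rw [← Finset.sum_filter]
  refine Finset.sum_congr ?_ fun _ _ => rfl
  ext v
  simp

theorem coeff_geodesicGrowthSeries (n : ℕ) :
    PowerSeries.coeff n (geodesicGrowthSeries (racgGenerators Γ)) =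
      ((reducedWords Γ n).card : ℚ) := by
  have hset : {x : List (racgGenerators Γ) | x ∈ geodesicLanguage (racgGenerators Γ) ∧
      x.length = n} = List.map (vertexEquivGenerators Γ) '' (reducedWords Γ n : Set (List V)) := by
    ext x
    obtain ⟨w, rfl⟩ := (vertexEquivGenerators Γ).surjective.list_map x
    rw [(List.map_injective_iff.2 (vertexEquivGenerators Γ).injective).mem_set_image]
    simp [map_mem_geodesicLanguage_iff, mem_reducedWords]
  rw [geodesicGrowthSeries, growthSeries, PowerSeries.coeff_mk, hset,
    Set.ncard_image_of_injective _ (List.map_injective_iff.2 (vertexEquivGenerators Γ).injective),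
    Set.ncard_coe_finset]

/-- Double counting of the pairs of a vertex `v` outside of a clique `σ` and a set of `i` vertices
of `σ` that are adjacent to `v`. -/
theorem sum_choose_card_neighbors {σ : Finset V} (hσ : Γ.IsClique (σ : Set V)) (i m : ℕ)
    (hm : ∀ τ : Finset V, Γ.IsNClique i τ → (cliqueLink Γ τ).ncard = m) :
    (∑ v ∈ σᶜ, (σ.filter (Γ.Adj v)).card.choose i) + (i + 1) * σ.card.choose (i + 1) =
      m * σ.card.choose i := by
  -- The link of τ ⊆ σ splits into the vertices outside σ adjacent to all of τ and the |σ| - i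
  -- vertices of σ \ τ. Summed over τ, the second part gives (|σ| - i) C(|σ|, i) = (i + 1) C(|σ|, i
  -- + 1).
  have hlink : ∀ τ ∈ σ.powersetCard i,
      (σᶜ.filter fun v => ∀ u ∈ τ, Γ.Adj v u).card + (σ.card - i) = m := by
    intro τ hτ
    obtain ⟨hsub, hcard⟩ := Finset.mem_powersetCard.1 hτ
    have hcl : Γ.IsClique (τ : Set V) := hσ.subset (by exact_mod_cast hsub)
    rw [← hm τ ⟨hcl, hcard⟩, ← hcard, ← Finset.card_sdiff_of_subset hsub,
      ← Finset.card_union_of_disjoint, ← Set.ncard_coe_finset]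
    · congr 1
      ext v
      simp only [Finset.coe_union, Finset.coe_filter, Finset.mem_compl, Finset.coe_sdiff,
        Set.mem_union, Set.mem_ofPred_eq, Set.mem_sdiff, Finset.mem_coe, cliqueLink,
        SimpleGraph.isClique_insert]
      constructor
      · rintro (⟨hv, hadj⟩ | ⟨hv, hvτ⟩)
        · exact ⟨fun h => hv (hsub h), hcl, fun u hu _ => hadj u hu⟩
        · exact ⟨hvτ, hcl, fun u hu hne => hσ hv (hsub hu) hne⟩
      · rintro ⟨hvτ, -, hadj⟩
        by_cases hv : v ∈ σ
        · exact Or.inr ⟨hv, hvτ⟩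
        · exact Or.inl ⟨hv, fun u hu => hadj u hu fun h => hvτ (h ▸ hu)⟩
    · rw [Finset.disjoint_left]
      intro v hv hv'
      exact Finset.mem_compl.1 (Finset.mem_filter.1 hv).1 (Finset.mem_sdiff.1 hv').1
  have hcount : ∑ v ∈ σᶜ, (σ.filter (Γ.Adj v)).card.choose i =
      ∑ τ ∈ σ.powersetCard i, (σᶜ.filter fun v => ∀ u ∈ τ, Γ.Adj v u).card := by
    refine Eq.trans ?_ (Finset.sum_card_bipartiteAbove_eq_sum_card_bipartiteBelow
      (fun v τ => ∀ u ∈ τ, Γ.Adj v u))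
    refine Finset.sum_congr rfl fun v _ => ?_
    rw [← Finset.card_powersetCard]
    congr 1
    ext τ
    simp only [Finset.mem_powersetCard, Finset.bipartiteAbove, Finset.mem_filter,
      Finset.subset_iff]
    grind
  have htotal := Finset.sum_congr rfl hlink
  rw [Finset.sum_add_distrib, ← hcount, Finset.sum_const, Finset.sum_const,
    Finset.card_powersetCard, smul_eq_mul, smul_eq_mul, ← Nat.choose_succ_right_eq] at htotal
  linarith

/-- The number of pairs of a reduced word of length `n` and a set of `i` of its descents. -/
def descentMoment (i n : ℕ) : ℕ :=
  ∑ w ∈ reducedWords Γ n, (leftDescents Γ w).card.choose i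

theorem descentMoment_zero_left (n : ℕ) : descentMoment Γ 0 n = (reducedWords Γ n).card := by
  simp [descentMoment]

theorem descentMoment_zero_right (i : ℕ) : descentMoment Γ i 0 = if i = 0 then 1 else 0 := by
  cases i <;> simp [descentMoment, reducedWords, leftDescents]

theorem descentMoment_eq_zero {k : ℕ} (hfree : Γ.CliqueFree k) (n : ℕ) :
    descentMoment Γ k n = 0 := by
  refine Finset.sum_eq_zero fun w _ => Nat.choose_eq_zero_of_lt ?_
  by_contra! h
  obtain ⟨τ, hτ, hcard⟩ := Finset.exists_subset_card_eq h
  exact hfree τ ⟨(isClique_leftDescents Γ w).subset (by exact_mod_cast hτ), hcard⟩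

theorem sum_descentMoment (i m n : ℕ)
    (hm : ∀ τ : Finset V, Γ.IsNClique i τ → (cliqueLink Γ τ).ncard = m) :
    (∑ w ∈ reducedWords Γ n, ∑ v ∈ (leftDescents Γ w)ᶜ,
      ((leftDescents Γ w).filter (Γ.Adj v)).card.choose i) +
        (i + 1) * descentMoment Γ (i + 1) n = m * descentMoment Γ i n := by
  rw [descentMoment, descentMoment, Finset.mul_sum, Finset.mul_sum, ← Finset.sum_add_distrib]
  exact Finset.sum_congr rfl fun w _ =>
    sum_choose_card_neighbors Γ (isClique_leftDescents Γ w) i m hm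

theorem card_leftDescents_cons {v : V} {w : List V} (hv : v ∈ (leftDescents Γ w)ᶜ) :
    (leftDescents Γ (v :: w)).card = ((leftDescents Γ w).filter (Γ.Adj v)).card + 1 := by
  rw [leftDescents, Finset.card_insert_of_notMem]
  exact fun h => Finset.mem_compl.1 hv (Finset.mem_filter.1 h).1

/-- A reduced word w has |V| - |D(w)| reduced extensions by one letter. -/
theorem descentMoment_zero_succ (n : ℕ) :
    descentMoment Γ 0 (n + 1) + descentMoment Γ 1 n = Nat.card V * descentMoment Γ 0 n := by
  rw [← sum_descentMoment Γ 0 (Nat.card V) n, descentMoment, sum_reducedWords_succ]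
  · simp
  · intro τ hτ
    obtain rfl := Finset.card_eq_zero.1 hτ.card_eq
    simp [cliqueLink, Set.ncard_univ]

/-- Prepending v leaves k + 1 descents, where k counts the old descents adjacent to v. Pascal's rule
splits C(k + 1, i + 1), and the double count evaluates both parts, using links of i-cliques and of
(i + 1)-cliques. -/
theorem descentMoment_succ_succ (i a b n : ℕ)
    (ha : ∀ τ : Finset V, Γ.IsNClique i τ → (cliqueLink Γ τ).ncard = a)
    (hb : ∀ τ : Finset V, Γ.IsNClique (i + 1) τ → (cliqueLink Γ τ).ncard = b) :
    descentMoment Γ (i + 1) (n + 1) + (i + 1) * descentMoment Γ (i + 1) n +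
        (i + 2) * descentMoment Γ (i + 2) n =
      a * descentMoment Γ i n + b * descentMoment Γ (i + 1) n := by
  rw [← sum_descentMoment Γ i a n ha, ← sum_descentMoment Γ (i + 1) b n hb]
  have : descentMoment Γ (i + 1) (n + 1) =
      (∑ w ∈ reducedWords Γ n, ∑ v ∈ (leftDescents Γ w)ᶜ,
        ((leftDescents Γ w).filter (Γ.Adj v)).card.choose i) +
      ∑ w ∈ reducedWords Γ n, ∑ v ∈ (leftDescents Γ w)ᶜ,
        ((leftDescents Γ w).filter (Γ.Adj v)).card.choose (i + 1) := by
    rw [descentMoment, sum_reducedWords_succ, ← Finset.sum_add_distrib]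
    refine Finset.sum_congr rfl fun w _ => ?_
    rw [← Finset.sum_add_distrib]
    refine Finset.sum_congr rfl fun v hv => ?_
    rw [card_leftDescents_cons Γ hv, Nat.choose_succ_succ]
  rw [this]
  ring

/-! ### Generating functions of the moments. -/

/-- The generating function of the descent moments of order `i`. -/
noncomputable def descentSeries (i : ℕ) : PowerSeries ℚ :=
  PowerSeries.mk fun n => (descentMoment Γ i n : ℚ)

theorem geodesicGrowthSeries_eq_descentSeries :
    geodesicGrowthSeries (racgGenerators Γ) = descentSeries Γ 0 := by
  ext n
  rw [coeff_geodesicGrowthSeries, descentSeries, PowerSeries.coeff_mk, descentMoment_zero_left]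

theorem descentSeries_eq_zero {k : ℕ} (hfree : Γ.CliqueFree k) : descentSeries Γ k = 0 := by
  ext n
  simp [descentSeries, descentMoment_eq_zero Γ hfree]

theorem descentSeries_zero :
    descentSeries Γ 0 =
      1 + PowerSeries.X * ((Nat.card V : PowerSeries ℚ) * descentSeries Γ 0 - descentSeries Γ 1) := by
  have hV : (Nat.card V : PowerSeries ℚ) = PowerSeries.C (Nat.card V : ℚ) := by simp
  rw [hV]
  ext n
  cases n with
  | zero => simp [descentSeries, descentMoment_zero_right]
  | succ n =>
    have h : (_ : ℚ) = _ := congrArg Nat.cast (descentMoment_zero_succ Γ n)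
    push_cast at h
    rw [map_add, PowerSeries.coeff_succ_X_mul, map_sub, PowerSeries.coeff_C_mul,
      PowerSeries.coeff_one]
    simp only [descentSeries, PowerSeries.coeff_mk]
    rw [if_neg n.succ_ne_zero]
    linarith

theorem descentSeries_succ (i a b : ℕ)
    (ha : ∀ τ : Finset V, Γ.IsNClique i τ → (cliqueLink Γ τ).ncard = a)
    (hb : ∀ τ : Finset V, Γ.IsNClique (i + 1) τ → (cliqueLink Γ τ).ncard = b) :
    descentSeries Γ (i + 1) =
      PowerSeries.X * ((a : PowerSeries ℚ) * descentSeries Γ i +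
        ((b : PowerSeries ℚ) - ((i : PowerSeries ℚ) + 1)) * descentSeries Γ (i + 1) -
        ((i : PowerSeries ℚ) + 2) * descentSeries Γ (i + 2)) := by
  have ha' : (a : PowerSeries ℚ) = PowerSeries.C (a : ℚ) := by simp
  have hb' : (b : PowerSeries ℚ) - ((i : PowerSeries ℚ) + 1) =
      PowerSeries.C ((b : ℚ) - (i + 1)) := by simp
  have hi' : (i : PowerSeries ℚ) + 2 = PowerSeries.C ((i : ℚ) + 2) := by
    rw [map_add, map_natCast, map_ofNat]
  rw [ha', hb', hi']
  ext n
  cases n with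
  | zero => simp [descentSeries, descentMoment_zero_right]
  | succ n =>
    have h : (_ : ℚ) = _ := congrArg Nat.cast (descentMoment_succ_succ Γ i a b n ha hb)
    push_cast at h
    rw [PowerSeries.coeff_succ_X_mul, map_sub, map_add, PowerSeries.coeff_C_mul,
      PowerSeries.coeff_C_mul, PowerSeries.coeff_C_mul]
    simp only [descentSeries, PowerSeries.coeff_mk]
    linarith

end Counting

/-! ### Solving the linear system. -/

theorem cliqueLink_eq_empty_of_cliqueFree {V : Type*} [DecidableEq V] {Γ : SimpleGraph V} {k : ℕ}
    (hfree : Γ.CliqueFree (k + 1)) {σ : Finset V} (hσ : Γ.IsNClique k σ) :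
    cliqueLink Γ σ = ∅ := by
  refine Set.eq_empty_of_forall_notMem fun v hv => hfree (insert v σ) ⟨?_, ?_⟩
  · simpa using hv.2
  · rw [Finset.card_insert_of_notMem hv.1, hσ.card_eq]

/-- Elimination in the linear system satisfied by the descent series. -/
theorem eliminate_descentSeries {R : Type*} [CommRing R] (a b c d z M₀ M₁ M₂ M₃ M₄ : R)
    (e0 : M₀ = 1 + z * (a * M₀ - M₁))
    (e1 : M₁ = z * (a * M₀ + (b - 1) * M₁ - 2 * M₂))
    (e2 : M₂ = z * (b * M₁ + (c - 2) * M₂ - 3 * M₃))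
    (e3 : M₃ = z * (c * M₂ + (d - 3) * M₃ - 4 * M₄))
    (e4 : M₄ = z * (d * M₃ - 4 * M₄)) :
    M₀ * ((a * b * c * d - 4 * a * b * c + 12 * a * b - 24 * a + 24) * z ^ 4
      + (-a * b * c - a * b * d - a * c * d - b * c * d + 7 * a * b + 4 * a * c
        + 4 * b * c + 2 * a * d + c * d - 26 * a - 12 * b - 4 * c - 2 * d + 50) * z ^ 3
      + (a * b + a * c + b * c + a * d + b * d + c * d
        - 9 * a - 7 * b - 5 * c - 3 * d + 35) * z ^ 2
      + (-a - b - c - d + 10) * z + 1) =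
    24 * z ^ 4 + (-b * c * d + 4 * b * c + c * d - 12 * b - 4 * c - 2 * d + 50) * z ^ 3
      + (b * c + b * d + c * d - 7 * b - 5 * c - 3 * d + 35) * z ^ 2
      + (-b - c - d + 10) * z + 1 := by
  -- Inclusion–exclusion: the alternating sum of C(|D(w)|, i) over i vanishes unless D(w) is empty,
  -- which happens only for the empty word. Being free of z, this relation keeps the determinant of
  -- the system at degree 4.
  have hM₄ : M₄ = 1 - M₀ + M₁ - M₂ + M₃ := by linear_combination e0 - e1 + e2 - e3 + e4
  rw [hM₄] at e3
  -- Cramer's rule: the multipliers are the cofactors of the M₀ column in the 4 × 4 system left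
  -- after eliminating M₄.
  linear_combination
    ((1 - (b - 1) * z) * ((1 - (c - 2) * z) * (1 - (d - 7) * z) + 3 * z ^ 2 * (4 + c))
      + 2 * b * z ^ 2 * (1 - (d - 7) * z) + 24 * z ^ 3) * e0
    - z * ((1 - (c - 2) * z) * (1 - (d - 7) * z) + 3 * z ^ 2 * (4 + c)) * e1
    + 2 * z ^ 2 * (1 - (d - 7) * z) * e2 - 6 * z ^ 3 * e3

/-- The geodesic growth series of `RACG Γ` is `q(z) / p(z)`, as a power series (`p` has constant
term `1`, so its power series inverse is a genuine one). The number `ℓ k` is the common size of the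
links of the `k`-cliques; it is unconstrained when there are no `k`-cliques. -/
theorem corollary6p5 {V : Type*} [Finite V] (Γ : SimpleGraph V)
    (hreg : IsLinkRegular Γ) (hfree : Γ.CliqueFree 5)
    (ℓ : ℕ → ℕ) (hℓ₀ : ℓ 0 = Nat.card V)
    (hℓ : ∀ k : ℕ, 1 ≤ k → k ≤ 3 → ∀ σ : Finset V, Γ.IsNClique k σ →
      (cliqueLink Γ σ).ncard = ℓ k) :
    geodesicGrowthSeries (racgGenerators Γ) =
      (numeratorPoly (ℓ 1) (ℓ 2) (ℓ 3) : PowerSeries ℚ) *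
        (denominatorPoly (ℓ 0) (ℓ 1) (ℓ 2) (ℓ 3) : PowerSeries ℚ)⁻¹ := by
  classical
  have := Fintype.ofFinite V
  have h4 : ∀ σ : Finset V, Γ.IsNClique 4 σ → (cliqueLink Γ σ).ncard = 0 := fun σ hσ => by
    rw [cliqueLink_eq_empty_of_cliqueFree hfree hσ, Set.ncard_empty]
  have h0 : ∀ σ : Finset V, Γ.IsNClique 0 σ → (cliqueLink Γ σ).ncard = ℓ 0 := fun σ hσ => by
    obtain rfl := Finset.card_eq_zero.1 hσ.card_eq
    simp [cliqueLink, Set.ncard_univ, hℓ₀]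
  have h1 := hℓ 1 le_rfl (by norm_num)
  have h2 := hℓ 2 (by norm_num) (by norm_num)
  have h3 := hℓ 3 (by norm_num) le_rfl
  have e0 := descentSeries_zero Γ
  have e1 := descentSeries_succ Γ 0 _ _ h0 h1
  have e2 := descentSeries_succ Γ 1 _ _ h1 h2
  have e3 := descentSeries_succ Γ 2 _ _ h2 h3
  have e4 := descentSeries_succ Γ 3 _ _ h3 h4
  -- The system closes here: the order-5 series vanishes, and the 4-clique link size in `e4` is 0.
  rw [descentSeries_eq_zero Γ hfree] at e4
  rw [← hℓ₀] at e0
  norm_num only [Nat.cast_ofNat, Nat.cast_zero, Nat.cast_one] at e1 e2 e3 e4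
  rw [PowerSeries.eq_mul_inv_iff_mul_eq, geodesicGrowthSeries_eq_descentSeries]
  · have key := eliminate_descentSeries (ℓ 0 : PowerSeries ℚ) (ℓ 1) (ℓ 2) (ℓ 3) PowerSeries.X
      (descentSeries Γ 0) (descentSeries Γ 1) (descentSeries Γ 2) (descentSeries Γ 3)
      (descentSeries Γ 4) e0 (by linear_combination e1) (by linear_combination e2)
      (by linear_combination e3) (by linear_combination e4)
    simp only [numeratorPoly, denominatorPoly, Polynomial.coe_add, Polynomial.coe_mul,
      Polynomial.coe_C, Polynomial.coe_X, Polynomial.coe_pow, Polynomial.coe_one]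
    simpa only [map_add, map_sub, map_mul, map_neg, map_ofNat, map_one, map_natCast] using key
  · rw [← PowerSeries.coeff_zero_eq_constantCoeff_apply, Polynomial.coeff_coe,
      denominatorPoly_coeff_zero]
    exact one_ne_zero
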